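/- Let $n\ge 1$ and let $K\subset\mathbb{R}^n$ be a non-empty compact convex set (interior points are not required) of constant width $\Theta$, i.e. $\sup_{x\in K}\langle x,u\rangle+\sup_{x\in K}\langle x,-u\rangle=\Theta$ for every unit vector $u\in S^{n-1}$. Let $\gamma=\varphi([a,b])$ be a curve, where $a\le b$ and $\varphi:[a,b]\to\mathbb{R}^n$ is continuous, such that $K$ is contained in the convex hull of $\gamma$. Then $$\operatorname{length}(\gamma)\;\ge\;2(\pi-1)\sqrt{\frac{n-1}{2\pi}}\;\Theta ,$$ where $\operatorname{length}(\gamma)\in[0,\infty]$ is the supremum of $\sum_{i=1}^m\|\varphi(t_i)-\varphi(t_{i-1})\|$ over all finite partitions $a=t_0<t_1<\dots<t_m=b$ of $[a,b]$, or $0$ if $a=b$. -/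

import Mathlib

/-- The support function `h(K, u) = sup {(x, u) | x ∈ K}` of a convex body `K` in `ℝⁿ`. -/
noncomputable def supportFun {n : ℕ} (K : ConvexBody (EuclideanSpace ℝ (Fin n)))
    (u : EuclideanSpace ℝ (Fin n)) : ℝ :=
  sSup ((fun x => inner ℝ x u) '' (K : Set (EuclideanSpace ℝ (Fin n))))

/-- The width function `w(K, u) = h(K, u) + h(K, -u)` (used for unit vectors `u`). -/
noncomputable def widthFun {n : ℕ} (K : ConvexBody (EuclideanSpace ℝ (Fin n)))
    (u : EuclideanSpace ℝ (Fin n)) : ℝ :=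
  supportFun K u + supportFun K (-u)

/-- `K` has constant width `Θ`: its width in every unit direction is `Θ`. -/
def HasConstantWidth {n : ℕ} (K : ConvexBody (EuclideanSpace ℝ (Fin n))) (Θ : ℝ) : Prop :=
  ∀ u ∈ Metric.sphere (0 : EuclideanSpace ℝ (Fin n)) 1, widthFun K u = Θ

/-- The length, in `[0, ∞]`, of the curve parametrized by `φ` on `[a, b]`: the supremum of the
lengths of the inscribed broken lines. -/
noncomputable def curveLength {n : ℕ} (φ : ℝ → EuclideanSpace ℝ (Fin n)) (a b : ℝ) : ENNReal :=
  eVariationOn φ (Set.Icc a b)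

/-! Take an orthonormal basis of the orthogonal complement of the chord `φ b - φ a`; it has `d ≥ n -
1` vectors. Each coordinate of the curve along it starts and ends at the same value and oscillates
by at least `Θ`, since the curve's hull contains `K`; so its variation is at least `2Θ`. Summing
over the `d` coordinates and applying Cauchy–Schwarz and Bessel to each segment of an inscribed
broken line gives `d · 2Θ ≤ √d · length`, that is, `length ≥ 2√d Θ ≥ 2√(n-1) Θ`. This is stronger
than the claim, because `(π - 1)² ≤ 2π`. -/

/-- The points of a nonempty finite set can be enumerated monotonically. -/
theorem exists_monotone_enum {α : Type*} [LinearOrder α] (T : Finset α) (hT : T.Nonempty) :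
    ∃ (u : ℕ → α) (N : ℕ), Monotone u ∧ (∀ k, u k ∈ T) ∧ ∀ x ∈ T, ∃ k ≤ N, u k = x := by
  have hc : 0 < T.card := hT.card_pos
  let e := T.orderIsoOfFin rfl
  refine ⟨fun k => e ⟨min k (T.card - 1), by omega⟩, T.card - 1, ?_, fun k => (e _).2, ?_⟩
  · intro i j hij
    refine Subtype.coe_le_coe.2 (e.monotone ?_)
    exact Fin.mk_le_mk.2 (min_le_min_right _ hij)
  · intro x hx
    obtain ⟨k, hk⟩ := e.surjective ⟨x, hx⟩
    refine ⟨k, by omega, ?_⟩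
    have : (⟨min (k : ℕ) (T.card - 1), by omega⟩ : Fin T.card) = k := Fin.ext (by simp; omega)
    simp only [this, hk]

/-- A closed walk in a metric space passing through two points has length at least twice
their distance. -/
theorem two_mul_dist_le_sum_dist {α : Type*} [PseudoMetricSpace α] (g : ℕ → α) {N p q : ℕ}
    (hp : p ≤ N) (hq : q ≤ N) (hg : g 0 = g N) :
    2 * dist (g p) (g q) ≤ ∑ k ∈ Finset.range N, dist (g k) (g (k + 1)) := by
  wlog hpq : p ≤ q generalizing p q
  · rw [dist_comm]; exact this hq hp (le_of_not_ge hpq)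
  have h1 := dist_le_Ico_sum_dist g (Nat.zero_le p)
  have h2 := dist_le_Ico_sum_dist g hpq
  have h3 := dist_le_Ico_sum_dist g hq
  have h4 := Finset.sum_Ico_consecutive (fun k => dist (g k) (g (k + 1))) (Nat.zero_le p) hpq
  have h5 := Finset.sum_Ico_consecutive (fun k => dist (g k) (g (k + 1))) (Nat.zero_le q) hq
  rw [Finset.range_eq_Ico]
  -- Since `g 0 = g N`, the rest of the walk, from `q` to `N` and from `0` to `p`, is a second route
  -- between the two points.
  have h6 := dist_triangle (g q) (g N) (g p)
  rw [dist_comm (g q) (g p), ← hg] at h6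
  rw [← hg] at h3
  linarith

theorem supportFun_le_of_subset_convexHull {n : ℕ}
    (K : ConvexBody (EuclideanSpace ℝ (Fin n))) {S : Set (EuclideanSpace ℝ (Fin n))}
    (hKS : (K : Set (EuclideanSpace ℝ (Fin n))) ⊆ convexHull ℝ S)
    {u : EuclideanSpace ℝ (Fin n)} {c : ℝ} (hc : ∀ x ∈ S, inner ℝ x u ≤ c) :
    supportFun K u ≤ c := by
  have hconv : Convex ℝ {x : EuclideanSpace ℝ (Fin n) | inner ℝ x u ≤ c} := by
    refine convex_halfSpace_le (f := fun x => inner ℝ x u) ⟨?_, ?_⟩ c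
    · intro x y; exact inner_add_left x y u
    · intro r x; exact real_inner_smul_left x u r
  refine csSup_le (K.nonempty.image _) ?_
  rintro _ ⟨x, hx, rfl⟩
  exact convexHull_min hc hconv (hKS hx)

/-- A linear functional is bounded on the hull by its extreme values on the curve, which are
attained by compactness. -/
theorem widthFun_le_of_subset_convexHull {n : ℕ}
    (K : ConvexBody (EuclideanSpace ℝ (Fin n))) {a b : ℝ} (hab : a ≤ b)
    {φ : ℝ → EuclideanSpace ℝ (Fin n)} (hφ : ContinuousOn φ (Set.Icc a b))
    (hcover : (K : Set (EuclideanSpace ℝ (Fin n))) ⊆ convexHull ℝ (φ '' Set.Icc a b))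
    (u : EuclideanSpace ℝ (Fin n)) :
    ∃ s ∈ Set.Icc a b, ∃ t ∈ Set.Icc a b,
      widthFun K u ≤ dist (inner ℝ (φ s) u) (inner ℝ (φ t) u) := by
  have hf : ContinuousOn (fun t => inner ℝ (φ t) u) (Set.Icc a b) := hφ.inner continuousOn_const
  have hne : (Set.Icc a b).Nonempty := Set.nonempty_Icc.2 hab
  obtain ⟨s, hs, hsm⟩ := isCompact_Icc.exists_isMaxOn hne hf
  obtain ⟨t, ht, htm⟩ := isCompact_Icc.exists_isMinOn hne hf
  refine ⟨s, hs, t, ht, ?_⟩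
  have h1 : supportFun K u ≤ inner ℝ (φ s) u := by
    refine supportFun_le_of_subset_convexHull K hcover ?_
    rintro _ ⟨r, hr, rfl⟩
    exact hsm hr
  have h2 : supportFun K (-u) ≤ -inner ℝ (φ t) u := by
    refine supportFun_le_of_subset_convexHull K hcover ?_
    rintro _ ⟨r, hr, rfl⟩
    rw [inner_neg_right]
    exact neg_le_neg (htm hr)
  rw [Real.dist_eq]
  refine le_trans ?_ (le_abs_self _)
  rw [widthFun]
  linarith

/-- Comparison of the `ℓ¹` norm of the coordinates along an orthonormal family with the norm. -/
theorem sum_abs_inner_le_sqrt_card_mul_norm {E ι : Type*} [NormedAddCommGroup E]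
    [InnerProductSpace ℝ E] [Fintype ι] {v : ι → E} (hv : Orthonormal ℝ v) (x : E) :
    ∑ i, |inner ℝ x (v i)| ≤ √(Fintype.card ι) * ‖x‖ := by
  have h1 : (∑ i, |inner ℝ x (v i)|) ^ 2 ≤ Fintype.card ι * ∑ i, |inner ℝ x (v i)| ^ 2 := by
    simpa using sq_sum_le_card_mul_sum_sq (s := Finset.univ) (f := fun i => |inner ℝ x (v i)|)
  have h2 : ∑ i, |inner ℝ x (v i)| ^ 2 ≤ ‖x‖ ^ 2 := by
    simpa [real_inner_comm] using hv.sum_inner_products_le x (s := Finset.univ)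
  refine abs_le_of_sq_le_sq' ?_ (by positivity) |>.2
  rw [mul_pow, Real.sq_sqrt (Nat.cast_nonneg _)]
  exact h1.trans (by gcongr)

/-- A curve whose chord is orthogonal to an orthonormal family, and which oscillates by at least
`Θ` along each member of it, is at least as long as `2 √d Θ`, with `d` the size of the family. -/
theorem two_mul_sqrt_card_mul_le_eVariationOn {E ι : Type*} [NormedAddCommGroup E]
    [InnerProductSpace ℝ E] [Fintype ι] {v : ι → E} (hv : Orthonormal ℝ v)
    {a b : ℝ} (hab : a ≤ b) (φ : ℝ → E) {Θ : ℝ}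
    (hclosed : ∀ i, inner ℝ (φ a) (v i) = inner ℝ (φ b) (v i))
    (hosc : ∀ i, ∃ s ∈ Set.Icc a b, ∃ t ∈ Set.Icc a b,
      Θ ≤ dist (inner ℝ (φ s) (v i)) (inner ℝ (φ t) (v i))) :
    ENNReal.ofReal (2 * √(Fintype.card ι) * Θ) ≤ eVariationOn φ (Set.Icc a b) := by
  classical
  choose s hs t ht hst using hosc
  -- One partition serves all directions at once; including `a` and `b` makes every coordinate walk
  -- closed.
  let T : Finset ℝ := {a, b} ∪ (Finset.univ.image s ∪ Finset.univ.image t)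
  have haT : a ∈ T := by simp [T]
  have hbT : b ∈ T := by simp [T]
  have hT : ∀ x ∈ T, x ∈ Set.Icc a b := by
    intro x hx
    simp only [T, Finset.mem_union, Finset.mem_insert, Finset.mem_singleton, Finset.mem_image,
      Finset.mem_univ, true_and] at hx
    rcases hx with (rfl | rfl) | ⟨i, rfl⟩ | ⟨i, rfl⟩
    · exact Set.left_mem_Icc.2 hab
    · exact Set.right_mem_Icc.2 hab
    · exact hs i
    · exact ht i
  obtain ⟨u, N, hu, huT, hTu⟩ := exists_monotone_enum T ⟨a, haT⟩
  have hu0 : u 0 = a := by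
    obtain ⟨k, -, hk⟩ := hTu a haT
    exact le_antisymm (hk ▸ hu (Nat.zero_le k)) (hT _ (huT 0)).1
  have huN : u N = b := by
    obtain ⟨k, hkN, hk⟩ := hTu b hbT
    exact le_antisymm (hT _ (huT N)).2 (hk ▸ hu hkN)
  set P : ℝ := ∑ k ∈ Finset.range N, dist (φ (u (k + 1))) (φ (u k)) with hP
  have hPle : ENNReal.ofReal P ≤ eVariationOn φ (Set.Icc a b) := by
    rw [hP, ENNReal.ofReal_sum_of_nonneg fun _ _ => dist_nonneg]
    simp only [← edist_dist]
    exact eVariationOn.sum_le hu fun k => hT _ (huT k)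
  refine le_trans (ENNReal.ofReal_le_ofReal ?_) hPle
  have hcoord : ∀ i, 2 * Θ ≤
      ∑ k ∈ Finset.range N, |inner ℝ (φ (u (k + 1)) - φ (u k)) (v i)| := by
    intro i
    obtain ⟨p, hp, hps⟩ := hTu (s i) (by simp [T])
    obtain ⟨q, hq, hqt⟩ := hTu (t i) (by simp [T])
    have h := two_mul_dist_le_sum_dist (fun k => (inner ℝ (φ (u k)) (v i) : ℝ)) hp hq
      (by simp only [hu0, huN]; exact hclosed i)
    simp only [hps, hqt] at h
    refine (mul_le_mul_of_nonneg_left (hst i) zero_le_two).trans (h.trans_eq ?_)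
    refine Finset.sum_congr rfl fun k _ => ?_
    rw [dist_comm, Real.dist_eq, inner_sub_left]
  have hsum : (Fintype.card ι : ℝ) * (2 * Θ) ≤ √(Fintype.card ι) * P := by
    calc (Fintype.card ι : ℝ) * (2 * Θ) = ∑ _i : ι, 2 * Θ := by simp
      _ ≤ ∑ i, ∑ k ∈ Finset.range N, |inner ℝ (φ (u (k + 1)) - φ (u k)) (v i)| :=
        Finset.sum_le_sum fun i _ => hcoord i
      _ = ∑ k ∈ Finset.range N, ∑ i, |inner ℝ (φ (u (k + 1)) - φ (u k)) (v i)| :=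
        Finset.sum_comm
      _ ≤ ∑ k ∈ Finset.range N, √(Fintype.card ι) * dist (φ (u (k + 1))) (φ (u k)) := by
        refine Finset.sum_le_sum fun k _ => ?_
        rw [dist_eq_norm]
        exact sum_abs_inner_le_sqrt_card_mul_norm hv _
      _ = √(Fintype.card ι) * P := by rw [hP, Finset.mul_sum]
  -- An empty family must be split off before cancelling `√d`.
  rcases (Real.sqrt_nonneg (Fintype.card ι : ℝ)).eq_or_lt with h0 | h0
  · rw [← h0, mul_zero, zero_mul]
    exact Finset.sum_nonneg fun _ _ => dist_nonneg
  · refine le_of_mul_le_mul_left ?_ h0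
    refine le_trans (le_of_eq ?_) hsum
    rw [← Real.mul_self_sqrt (Nat.cast_nonneg (α := ℝ) (Fintype.card ι)), Real.sqrt_mul_self h0.le]
    ring

theorem corollary1 (n : ℕ) (hn : 1 ≤ n) (K : ConvexBody (EuclideanSpace ℝ (Fin n))) (Θ : ℝ)
    (hK : HasConstantWidth K Θ)
    (a b : ℝ) (hab : a ≤ b) (φ : ℝ → EuclideanSpace ℝ (Fin n))
    (hφ : ContinuousOn φ (Set.Icc a b))
    (hcover : (K : Set (EuclideanSpace ℝ (Fin n))) ⊆ convexHull ℝ (φ '' Set.Icc a b)) :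
    ENNReal.ofReal (2 * (Real.pi - 1) * Real.sqrt (((n : ℝ) - 1) / (2 * Real.pi)) * Θ) ≤
      curveLength φ a b := by
  -- Project along the chord: the image is a closed curve in the hyperplane orthogonal to it.
  let W : Submodule ℝ (EuclideanSpace ℝ (Fin n)) := (ℝ ∙ (φ b - φ a))ᗮ
  let e := stdOrthonormalBasis ℝ W
  have hv : Orthonormal ℝ fun i => (e i : EuclideanSpace ℝ (Fin n)) :=
    e.orthonormal.comp_linearIsometry W.subtypeₗᵢ
  have hclosed : ∀ i, (inner ℝ (φ a) (e i : EuclideanSpace ℝ (Fin n)) : ℝ) =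
      inner ℝ (φ b) (e i : EuclideanSpace ℝ (Fin n)) := by
    intro i
    have h := Submodule.mem_orthogonal_singleton_iff_inner_right.1 (e i).2
    rw [inner_sub_left] at h
    linarith
  have hlen := two_mul_sqrt_card_mul_le_eVariationOn hv hab φ (Θ := Θ) hclosed fun i => by
    obtain ⟨s, hs, t, ht, hst⟩ := widthFun_le_of_subset_convexHull K hab hφ hcover
      (e i : EuclideanSpace ℝ (Fin n))
    exact ⟨s, hs, t, ht, (hK _ (by simpa using hv.1 i)) ▸ hst⟩
  -- Only an inequality: the chord spans a line, or nothing when the curve is closed.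
  have hdim : n - 1 ≤ Module.finrank ℝ W := by
    have h1 := Submodule.finrank_add_finrank_orthogonal (ℝ ∙ (φ b - φ a))
    have h2 := (finrank_span_le_card (R := ℝ) ({φ b - φ a} : Set (EuclideanSpace ℝ (Fin n))))
    rw [Set.toFinset_singleton, Finset.card_singleton] at h2
    rw [finrank_euclideanSpace_fin] at h1
    change n - 1 ≤ Module.finrank ℝ (ℝ ∙ (φ b - φ a))ᗮ
    omega
  have hdim' : (n : ℝ) - 1 ≤ (Module.finrank ℝ W : ℝ) := by
    have : n ≤ Module.finrank ℝ W + 1 := by omega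
    have : (n : ℝ) ≤ (Module.finrank ℝ W : ℝ) + 1 := by exact_mod_cast this
    linarith
  rw [Fintype.card_fin] at hlen
  refine le_trans ?_ hlen
  rcases lt_or_ge Θ 0 with hΘ | hΘ
  · rw [ENNReal.ofReal_of_nonpos]
    · exact bot_le
    · have := Real.pi_gt_three
      exact mul_nonpos_of_nonneg_of_nonpos
        (mul_nonneg (by linarith) (Real.sqrt_nonneg _)) hΘ.le
  refine ENNReal.ofReal_le_ofReal (mul_le_mul_of_nonneg_right ?_ hΘ)
  have hπ := Real.pi_gt_three
  have hπ' := Real.pi_lt_d2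
  have hn' : (0 : ℝ) ≤ (n : ℝ) - 1 := by
    have : (1 : ℝ) ≤ n := by exact_mod_cast hn
    linarith
  rw [mul_assoc]
  refine mul_le_mul_of_nonneg_left (Real.le_sqrt_of_sq_le ?_) zero_le_two
  rw [mul_pow, Real.sq_sqrt (by positivity), ← mul_div_assoc]
  refine le_trans ?_ hdim'
  rw [div_le_iff₀ (by positivity), mul_comm]
  -- The numerical fact is `(π - 1)² ≤ 2π`, from `3 < π < 3.15`.
  exact mul_le_mul_of_nonneg_left (by nlinarith) hn'
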